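/- Let $n \ge 0$ be an integer, and consider $n$ gossipers, each of whom initially knows exactly one item of gossip, his own, the $n$ items being distinct. In a phone call between two distinct gossipers, each tells the other everything he knows, so that afterwards both know every item that at least one of them knew before the call; the knowledge of all other gossipers is unchanged. Then any finite sequence of phone calls, made one after the other, such that in each call at least one of the two participants learns an item he did not know before, has length at most $\binom{n}{2}$. Moreover, this bound is attained: for every $n$ there is such a sequence of length exactly $\binom{n}{2}$. -/

import Mathlib

namespace Gossip

/-- A state of knowledge among `n` gossipers: `K j` is the set of gossip items known to
gossiper `j`, where item `i` is the one that initially belongs to gossiper `i`. -/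
abbrev Knowledge (n : ℕ) : Type := Fin n → Finset (Fin n)

/-- Initially every gossiper knows exactly his own item. -/
def initial (n : ℕ) : Knowledge n := fun j => {j}

/-- The state after a call between the two members of the unordered pair `e`: each of the
two participants then knows everything that either of them knew before, and nobody else's
knowledge changes. -/
def afterCall {n : ℕ} (K : Knowledge n) (e : Sym2 (Fin n)) : Knowledge n :=
  fun j => if j ∈ e then e.toFinset.biUnion K else K j

/-- In the state `K`, the call `e` teaches at least one of its participants an item that
this participant did not know before. -/
def Teaches {n : ℕ} (K : Knowledge n) (e : Sym2 (Fin n)) : Prop :=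
  ∃ j ∈ e, ∃ i ∈ afterCall K e j, i ∉ K j

/-- Starting from the state `K`, the calls in the list, made one after the other, are calls
between two distinct gossipers, and each of them teaches at least one participant something
new. -/
def EveryCallTeaches {n : ℕ} : Knowledge n → List (Sym2 (Fin n)) → Prop
  | _, [] => True
  | K, e :: calls => ¬ e.IsDiag ∧ Teaches K e ∧ EveryCallTeaches (afterCall K e) calls

end Gossip

namespace Gossip

open Matrix

variable {n : ℕ}

/-! For the upper bound, a state is modelled by an orthogonal matrix `P` with support exactly `K`,
together with a space `W` of skew-symmetric `X` for which `P * X` is supported on `K`. A call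
between `i` and `j` multiplies `P` on the left by a generic rotation in the `i`, `j` plane, so that
rows `i` and `j` both acquire the union of their supports. The old `W` survives, and the direction
of the rotation itself joins it. That direction is new as soon as somebody learns something
(`IsRealization.exists_afterCall`). Hence every call raises `dim W`, which never exceeds the
dimension `n.choose 2` of the skew-symmetric matrices. For sharpness, gossipers `0, 1, …` in turn
call everybody after them in increasing order (`exists_calls_of_phase`). -/

theorem afterCall_mk (K : Knowledge n) (i j a : Fin n) :
    afterCall K s(i, j) a = if a = i ∨ a = j then K i ∪ K j else K a := by
  simp [afterCall, Sym2.toFinset_mk_eq]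

/-- If `i` learns something from the call `s(i, j)`, then `j` knows an item unknown to `i`. -/
theorem Teaches.exists_mk {K : Knowledge n} {e : Sym2 (Fin n)} (h : Teaches K e) :
    ∃ i j m, e = s(i, j) ∧ m ∈ K j ∧ m ∉ K i := by
  obtain ⟨i, ⟨j, rfl⟩, m, hm, hmi⟩ := h
  refine ⟨i, j, m, rfl, ?_, hmi⟩
  simpa [afterCall_mk, hmi] using hm

/-- The rotation with cosine `c` and sine `s` in the plane of the coordinates `i` and `j`. -/
def planeRotation (i j : Fin n) (c s : ℝ) : Matrix (Fin n) (Fin n) ℝ :=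
  of fun a b => if a = i then (if b = i then c else 0) + (if b = j then s else 0)
    else if a = j then (if b = j then c else 0) - (if b = i then s else 0)
    else if b = a then 1 else 0

theorem planeRotation_mul_apply (i j : Fin n) (c s : ℝ) (M : Matrix (Fin n) (Fin n) ℝ)
    (a m : Fin n) :
    (planeRotation i j c s * M) a m =
      if a = i then c * M i m + s * M j m
      else if a = j then c * M j m - s * M i m else M a m := by
  rw [mul_apply]
  simp only [planeRotation, of_apply]
  split_ifs <;> simp [add_mul, sub_mul, Finset.sum_add_distrib, Finset.sum_sub_distrib]

theorem planeRotation_mul_transpose {i j : Fin n} (hij : i ≠ j) {c s : ℝ}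
    (hcs : c ^ 2 + s ^ 2 = 1) : planeRotation i j c s * (planeRotation i j c s)ᵀ = 1 := by
  ext a b
  rw [planeRotation_mul_apply]
  simp only [planeRotation, transpose_apply, of_apply, one_apply]
  split_ifs <;> subst_vars <;> simp_all <;> linarith

/-- The infinitesimal rotation in the plane of the coordinates `i` and `j`. -/
def planeGenerator (i j : Fin n) : Matrix (Fin n) (Fin n) ℝ :=
  single i j 1 - single j i 1

theorem planeGenerator_transpose (i j : Fin n) :
    (planeGenerator i j)ᵀ = -planeGenerator i j := by
  simp [planeGenerator]

theorem planeGenerator_mul_apply (i j : Fin n) (M : Matrix (Fin n) (Fin n) ℝ) (a m : Fin n) :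
    (planeGenerator i j * M) a m =
      (if a = i then M j m else 0) - (if a = j then M i m else 0) := by
  rw [planeGenerator, sub_mul, Matrix.sub_apply]
  congr 1 <;> simp [mul_apply, single_apply, ite_and, eq_comm]

/-- Some rotation avoids all cancellations between finitely many pairs of coordinates. -/
theorem exists_generic_rotation (u v : Fin n → ℝ) :
    ∃ c s : ℝ, c ^ 2 + s ^ 2 = 1 ∧ ∀ m, u m ≠ 0 ∨ v m ≠ 0 →
      c * u m + s * v m ≠ 0 ∧ c * v m - s * u m ≠ 0 := by
  -- `t` is the tangent of the angle, and each `m` forbids at most two values. A zero denominator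
  -- makes the quotient `0`, which only excludes `t = 0` as well.
  obtain ⟨t, ht⟩ := Infinite.exists_notMem_finset
    (Finset.univ.image (fun m => -(u m / v m)) ∪ Finset.univ.image (fun m => v m / u m))
  have ht1 : ∀ m, -(u m / v m) ≠ t := by simp at ht; exact ht.1
  have ht2 : ∀ m, v m / u m ≠ t := by simp at ht; exact ht.2
  have hpos : 0 < 1 + t ^ 2 := by positivity
  have hr : 0 < √(1 + t ^ 2) := Real.sqrt_pos.2 hpos
  have hsq : √(1 + t ^ 2) ^ 2 = 1 + t ^ 2 := Real.sq_sqrt hpos.le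
  refine ⟨1 / √(1 + t ^ 2), t / √(1 + t ^ 2), ?_, fun m hm => ⟨fun h => ?_, fun h => ?_⟩⟩
  · rw [div_pow, div_pow, hsq]
    field_simp
  · have h' : u m + t * v m = 0 := by
      field_simp at h
      linarith
    by_cases hv : v m = 0
    · simp_all
    · exact ht1 m (by field_simp; linarith)
  · have h' : v m - t * u m = 0 := by
      field_simp at h
      linarith
    by_cases hu : u m = 0
    · simp_all
    · exact ht2 m (by field_simp; linarith)

/-- The space of skew-symmetric real matrices. -/
def skewMatrices (n : ℕ) : Submodule ℝ (Matrix (Fin n) (Fin n) ℝ) where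
  carrier := {X | Xᵀ = -X}
  add_mem' {X Y} hX hY := by
    simp only [Set.mem_ofPred_eq] at *
    rw [transpose_add, hX, hY, neg_add]
  zero_mem' := by simp
  smul_mem' c X hX := by
    simp only [Set.mem_ofPred_eq] at *
    rw [transpose_smul, hX, smul_neg]

theorem mem_skewMatrices {X : Matrix (Fin n) (Fin n) ℝ} : X ∈ skewMatrices n ↔ Xᵀ = -X :=
  Iff.rfl

/-- A skew-symmetric matrix is determined by its entries above the diagonal, indexed here by
unordered pairs of distinct indices. -/
theorem finrank_skewMatrices_le (n : ℕ) :
    Module.finrank ℝ (skewMatrices n) ≤ n.choose 2 := by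
  let f : skewMatrices n →ₗ[ℝ] ({e : Sym2 (Fin n) // ¬ e.IsDiag} → ℝ) :=
    { toFun := fun X e => X.1 e.1.inf e.1.sup
      map_add' := fun _ _ => rfl
      map_smul' := fun _ _ => rfl }
  have hf : Function.Injective f := by
    rw [injective_iff_map_eq_zero]
    intro X hX
    have hskew : ∀ i j, X.1 i j = -X.1 j i := fun i j =>
      congrFun (congrFun (mem_skewMatrices.1 X.2) j) i
    have hlt : ∀ i j, i < j → X.1 i j = 0 := fun i j hij => by
      have := congrFun hX ⟨s(i, j), by simpa using hij.ne⟩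
      change X.1 s(i, j).inf s(i, j).sup = 0 at this
      simpa [hij.le] using this
    ext i j
    rcases lt_trichotomy i j with h | rfl | h
    · exact hlt i j h
    · have := hskew i i
      simp only [ZeroMemClass.coe_zero, Matrix.zero_apply]
      linarith
    · rw [hskew, hlt j i h]
      simp
  calc Module.finrank ℝ (skewMatrices n)
      ≤ Module.finrank ℝ ({e : Sym2 (Fin n) // ¬ e.IsDiag} → ℝ) :=
        LinearMap.finrank_le_finrank_of_injective hf
    _ = n.choose 2 := by
        rw [Module.finrank_fintype_fun_eq_card, Sym2.card_subtype_not_diag, Fintype.card_fin]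

/-- The orthogonal matrix `P` has support exactly `K`, and `W` is a space of skew-symmetric
matrices such that the tangent vectors `P * X` at `P`, for `X` in `W`, are supported on `K`. -/
structure IsRealization (K : Knowledge n) (P : Matrix (Fin n) (Fin n) ℝ)
    (W : Submodule ℝ (Matrix (Fin n) (Fin n) ℝ)) : Prop where
  mul_transpose : P * Pᵀ = 1
  ne_zero_iff : ∀ j m, P j m ≠ 0 ↔ m ∈ K j
  le_skew : W ≤ skewMatrices n
  mul_eq_zero : ∀ X ∈ W, ∀ j m, m ∉ K j → (P * X) j m = 0

theorem isRealization_initial : IsRealization (initial n) 1 ⊥ where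
  mul_transpose := by simp
  ne_zero_iff j m := by simp [initial, one_apply, eq_comm]
  le_skew := bot_le
  mul_eq_zero X hX j m _ := by
    rw [(Submodule.mem_bot ℝ).1 hX]
    simp

/-- A call that teaches something enlarges the space of tangent vectors. -/
theorem IsRealization.exists_afterCall {K : Knowledge n} {P : Matrix (Fin n) (Fin n) ℝ}
    {W : Submodule ℝ (Matrix (Fin n) (Fin n) ℝ)} (h : IsRealization K P W)
    {e : Sym2 (Fin n)} (hd : ¬ e.IsDiag) (he : Teaches K e) :
    ∃ P' W', IsRealization (afterCall K e) P' W' ∧ W < W' := by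
  obtain ⟨i, j, l, rfl, hlj, hli⟩ := he.exists_mk
  have hij : i ≠ j := by simpa using hd
  have hzero : ∀ a m, m ∉ K a → P a m = 0 := fun a m hm => by
    by_contra hne
    exact hm ((h.ne_zero_iff a m).1 hne)
  obtain ⟨c, s, hcs, hgen⟩ := exists_generic_rotation (P i) (P j)
  set R := planeRotation i j c s with hR
  -- Chosen so that `P * X₀` is the velocity of `P` under rotation in the `i`, `j` plane.
  set X₀ := Pᵀ * (planeGenerator i j * P) with hX₀
  have hPX₀ : P * X₀ = planeGenerator i j * P := by
    rw [hX₀, ← Matrix.mul_assoc, h.mul_transpose, Matrix.one_mul]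
  -- Row `i` of `P * X₀` is row `j` of `P`, which is nonzero at the item `l` unknown to `i`.
  have hnotMem : X₀ ∉ W := fun hmem => by
    have h0 := h.mul_eq_zero X₀ hmem i l hli
    rw [hPX₀, planeGenerator_mul_apply, if_pos rfl, if_neg hij, sub_zero] at h0
    exact (h.ne_zero_iff j l).2 hlj h0
  refine ⟨R * P, W ⊔ Submodule.span ℝ {X₀}, ⟨?_, ?_, ?_, ?_⟩, ?_⟩
  · calc R * P * (R * P)ᵀ = R * (P * Pᵀ) * Rᵀ := by
          simp only [transpose_mul, Matrix.mul_assoc]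
      _ = 1 := by rw [h.mul_transpose, Matrix.mul_one, planeRotation_mul_transpose hij hcs]
  · intro a m
    rw [hR, planeRotation_mul_apply, afterCall_mk]
    by_cases ha : a = i ∨ a = j
    · rw [if_pos ha, Finset.mem_union, ← h.ne_zero_iff, ← h.ne_zero_iff]
      by_cases hm : P i m ≠ 0 ∨ P j m ≠ 0
      · have hg := hgen m hm
        simp only [hm, iff_true]
        split_ifs with h1 h2
        · exact hg.1
        · exact hg.2
        · exact absurd ha (by tauto)
      · have hm' : P i m = 0 ∧ P j m = 0 := by simpa using hm
        split_ifs <;> simp_all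
    · have ha' := not_or.1 ha
      rw [if_neg ha'.1, if_neg ha'.2, if_neg ha, h.ne_zero_iff]
  · refine sup_le h.le_skew ?_
    rw [Submodule.span_singleton_le_iff_mem, mem_skewMatrices, hX₀]
    simp [planeGenerator_transpose, Matrix.mul_assoc]
  · intro X hX a m hm
    -- `R` mixes rows `i` and `j`, so both must vanish in column `m`; any other row is left alone.
    have key : ∀ M : Matrix (Fin n) (Fin n) ℝ, M i m = 0 ∨ (a ≠ i ∧ a ≠ j) →
        M j m = 0 ∨ (a ≠ i ∧ a ≠ j) → ((a ≠ i ∧ a ≠ j) → M a m = 0) → (R * M) a m = 0 := by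
      intro M h1 h2 h3
      rw [hR, planeRotation_mul_apply]
      split_ifs <;> simp_all
    obtain ⟨Y, hY, Z, hZ, rfl⟩ := Submodule.mem_sup.1 hX
    obtain ⟨r, rfl⟩ := Submodule.mem_span_singleton.1 hZ
    have hP : P * (Y + r • X₀) = P * Y + r • (planeGenerator i j * P) := by
      rw [Matrix.mul_add, Matrix.mul_smul, hPX₀]
    have hY0 := h.mul_eq_zero Y hY
    rw [Matrix.mul_assoc, hP]
    rw [afterCall_mk] at hm
    by_cases ha : a = i ∨ a = j
    · rw [if_pos ha, Finset.mem_union, not_or] at hm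
      apply key
      · simp [planeGenerator_mul_apply, hij, hY0 i m hm.1, hzero j m hm.2]
      · simp [planeGenerator_mul_apply, hij.symm, hY0 j m hm.2, hzero i m hm.1]
      · tauto
    · rw [if_neg ha] at hm
      have ha' := not_or.1 ha
      refine key _ (Or.inr ha') (Or.inr ha') fun _ => ?_
      simp [planeGenerator_mul_apply, ha'.1, ha'.2, hY0 a m hm]
  · refine lt_of_le_of_ne le_sup_left fun heq => hnotMem ?_
    rw [heq]
    exact Submodule.mem_sup_right (Submodule.mem_span_singleton_self X₀)

theorem IsRealization.finrank_add_length_le (calls : List (Sym2 (Fin n))) {K : Knowledge n}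
    {P : Matrix (Fin n) (Fin n) ℝ} {W : Submodule ℝ (Matrix (Fin n) (Fin n) ℝ)}
    (h : IsRealization K P W) (hc : EveryCallTeaches K calls) :
    Module.finrank ℝ W + calls.length ≤ n.choose 2 := by
  induction calls generalizing K P W with
  | nil => exact (Submodule.finrank_mono h.le_skew).trans (finrank_skewMatrices_le n)
  | cons e calls ih =>
    obtain ⟨hd, ht, hrest⟩ := hc
    obtain ⟨P', W', h', hlt⟩ := h.exists_afterCall hd ht
    have h1 := ih h' hrest
    have h2 := Submodule.finrank_lt_finrank_of_lt hlt
    rw [List.length_cons]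
    omega

/-- If `i` knows no item from `k` on, then calling `k, k + 1, …, n - 1` teaches `i` an item
each time, and leaves those called without the items beyond their own. -/
theorem exists_calls_of_phase (i : Fin n) {L : ℕ}
    (hnext : ∀ K : Knowledge n, (∀ a, a ∈ K a) → (∀ a, i < a → ∀ m ∈ K a, m ≤ a) →
      ∃ calls, EveryCallTeaches K calls ∧ calls.length = L) (d k : ℕ) (hk : k + d = n)
    (hik : i.val < k) (K : Knowledge n) (hself : ∀ a, a ∈ K a)
    (hle : ∀ a, i < a → ∀ m ∈ K a, m ≤ a) (hi : ∀ m ∈ K i, m.val < k) :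
    ∃ calls, EveryCallTeaches K calls ∧ calls.length = d + L := by
  induction d generalizing k K with
  | zero => simpa using hnext K hself hle
  | succ d ih =>
    let b : Fin n := ⟨k, by omega⟩
    have hib : i < b := hik
    obtain ⟨calls, hc, hlen⟩ := ih (k + 1) (by omega) (by omega) (afterCall K s(i, b))
      (fun a => by
        rw [afterCall_mk]
        split_ifs with h
        · rcases h with rfl | rfl <;> simp [hself]
        · exact hself a)
      (fun a ha m hm => by
        rw [afterCall_mk] at hm
        split_ifs at hm with h
        · obtain rfl := h.resolve_left ha.ne'
          rcases Finset.mem_union.1 hm with hm | hm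
          · exact (show m < b from hi m hm).le
          · exact hle _ ha m hm
        · exact hle a ha m hm)
      (fun m hm => by
        rw [afterCall_mk, if_pos (Or.inl rfl)] at hm
        rcases Finset.mem_union.1 hm with hm | hm
        · exact (hi m hm).trans (Nat.lt_succ_self k)
        · exact Nat.lt_succ_of_le (hle b hib m hm))
    -- The item learnt by `i` is that of `b` itself, since `i` knows only items below `k`.
    refine ⟨s(i, b) :: calls, ⟨by simpa using hib.ne, ⟨i, by simp, b, ?_, ?_⟩, hc⟩, ?_⟩
    · simp [afterCall_mk, hself]
    · exact fun h => lt_irrefl _ (hi b h)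
    · rw [List.length_cons, hlen]
      omega

/-- Only gossipers from `i` on are constrained: once a phase is over, its caller makes and receives
no further calls. The phase of `i` has `d - 1` calls when `d > 0`, and Pascal's rule adds up the
phases. -/
theorem exists_calls_length_choose (d i : ℕ) (hi : i + d = n) (K : Knowledge n)
    (hself : ∀ a, a ∈ K a) (hle : ∀ a : Fin n, i ≤ a.val → ∀ m ∈ K a, m ≤ a) :
    ∃ calls, EveryCallTeaches K calls ∧ calls.length = d.choose 2 := by
  induction d generalizing i K with
  | zero => exact ⟨[], trivial, rfl⟩
  | succ d ih =>
    have hin : i < n := by omega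
    obtain ⟨calls, hc, hlen⟩ := exists_calls_of_phase (⟨i, hin⟩ : Fin n) (L := d.choose 2)
      (fun K' hself' hle' => ih (i + 1) (by omega) K' hself' fun a ha => hle' a ha)
      d (i + 1) (by omega) (Nat.lt_succ_self i) K hself
      (fun a ha => hle a (le_of_lt (show i < a.val from ha)))
      (fun m hm => Nat.lt_succ_of_le (hle ⟨i, hin⟩ le_rfl m hm))
    refine ⟨calls, hc, ?_⟩
    rw [hlen, Nat.choose_succ_succ' d 1, Nat.choose_one_right]

end Gossip

theorem theorem1p4 (n : ℕ) :
    (∀ calls : List (Sym2 (Fin n)),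
      Gossip.EveryCallTeaches (Gossip.initial n) calls → calls.length ≤ n.choose 2) ∧
    (∃ calls : List (Sym2 (Fin n)),
      Gossip.EveryCallTeaches (Gossip.initial n) calls ∧ calls.length = n.choose 2) := by
  constructor
  · intro calls hc
    exact (Nat.le_add_left _ _).trans
      (Gossip.isRealization_initial.finrank_add_length_le calls hc)
  · refine Gossip.exists_calls_length_choose n 0 (zero_add n) _ (fun a => ?_) fun a _ m hm => ?_
    · simp [Gossip.initial]
    · exact (Finset.mem_singleton.1 hm).le
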